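/- Let $(N_t)_{t\ge0}$ be a non-homogeneous Poisson process with locally integrable intensity $\lambda\ge0$ on $[0,\infty)$, cumulated intensity $\Lambda(t)=\int_0^t\lambda(x)\,dx$, and successive points $T_1,T_2,\dots$ Let $V_i=(V_i^{(1)},V_i^{(2)})$, $i\ge1$, be i.i.d. random vectors with values in $[0,\infty)^2$ and common distribution $\mu$, independent of $(N_t)_{t\ge0}$, and let $A_t=(A_t^{(1)},A_t^{(2)})=\sum_{k=1}^{N_t}V_k$. Let $(G_t)_{t\ge0}$ be a nonnegative increasing stochastic process, independent of $(A_t)_{t\ge0}$, let $F_{G_t}$ be the distribution function of $G_t$, let $p:[0,\infty)\to[0,1]$ be measurable and $q=1-p$. For $t\ge0$ and $L\ge 0$ set $$\phi_t(L)=\mathbb E\Big(F_{G_t}\big(L-A_t^{(2)}\big)\,e^{-\int_0^tA_s^{(1)}\,ds}\prod_{i=1}^{N_t}q(T_i)\Big).$$ For $u,s\ge0$ let $\tilde\mu(u,s)=\iint_{\mathbb R_+^2}e^{-uv_1-sv_2}\,\mu(dv_1,dv_2)$, and let $\tilde\mu_1,\tilde\mu_2$ be the Laplace transforms of the two marginals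 $\mu_1,\mu_2$ of $\mu$. For a function $f\ge0$ on $[0,\infty)$ write $\tilde f(s)=\int_0^\infty e^{-sL}f(L)\,dL\in[0,\infty]$, and for functions $f,g$ on $[0,\infty)$ write $(f*g)(t)=\int_0^tf(z)g(t-z)\,dz$. Then, for every $t\ge0$: 1. $\tilde\phi_t(s)=\tilde F_{G_t}(s)\,\tilde\nu_t(s)$ for all $s\ge0$, where $$\tilde\nu_t(s)=\exp\big(-\Lambda(t)+((q\lambda)*\tilde\mu(\cdot,s))(t)\big);$$ 2. there is exactly one finite measure $\nu_t$ on $[0,\infty)$ whose Laplace transform $\int_{[0,\infty)}e^{-sx}\,\nu_t(dx)$ equals $\tilde\nu_t(s)$ for all $s\ge0$, and $$\phi_t(L)=(F_{G_t}*\nu_t)(L)=\int_{[0,L]}F_{G_t}(L-x)\,\nu_t(dx)\quad\text{for all }L\ge0;$$ 3. if the two components of $V_1$ are independent, then $\tilde\nu_t(s)=\exp\big(-\Lambda(t)+a(t)\,\tilde\mu_2(s)\big)$ for all $s\ge0$, where $a(t)=(\tilde\mu_1*(q\lambda))(t)$. -/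

import Mathlib

open MeasureTheory ProbabilityTheory
open scoped NNReal ENNReal

noncomputable section

namespace ShockModel

variable {Ω : Type*} [MeasurableSpace Ω]

/-- `N` is (under `P`) a non-homogeneous Poisson process with intensity `lam x dx` on `[0, ∞)`:
it starts from `0`, its paths are a.s. nondecreasing and right-continuous, its increments are
independent, and `N t - N s` is Poisson distributed with mean `∫_s^t lam`. -/
structure IsPoissonProcess (P : Measure Ω) (N : ℝ≥0 → Ω → ℕ) (lam : ℝ → ℝ) : Prop where
  measurable : ∀ t, Measurable (N t)
  zero : ∀ᵐ ω ∂P, N 0 ω = 0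
  monotone : ∀ᵐ ω ∂P, Monotone fun t => N t ω
  rightCont : ∀ᵐ ω ∂P, ∀ t, ContinuousWithinAt (fun u => N u ω) (Set.Ici t) t
  indepIncrements : HasIndepIncrements N P
  law : ∀ s t : ℝ≥0, s ≤ t →
    HasLaw (fun ω => N t ω - N s ω) (poissonMeasure (∫ x in (s : ℝ)..t, lam x).toNNReal) P

/-- The arrival time of shock number `i + 1`, i.e. the first time at which `N` is at least `i + 1`.
It is only used for `i < N t ω`, when the set below is nonempty. -/
def arrival (N : ℝ≥0 → Ω → ℕ) (i : ℕ) (ω : Ω) : ℝ≥0 :=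
  sInf {s : ℝ≥0 | i + 1 ≤ N s ω}

/-- The bivariate compound process `A_t = (∑_{k ≤ N_t} V_k⁽¹⁾, ∑_{k ≤ N_t} V_k⁽²⁾)`; the increment
caused by shock number `i + 1` is `V i`. -/
def compound (N : ℝ≥0 → Ω → ℕ) (V : ℕ → Ω → ℝ × ℝ) (t : ℝ≥0) (ω : Ω) : ℝ × ℝ :=
  ∑ k ∈ Finset.range (N t ω), V k ω

/-- The standing assumptions: `lam` is the intensity of the shock process `N`, `p x` the probability
that a shock at time `x` is fatal, `V` the i.i.d. sequence of nonnegative increments with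
distribution `μ`, and `G` the nonnegative increasing intrinsic deterioration. -/
structure IsShockModel (P : Measure Ω) (N : ℝ≥0 → Ω → ℕ) (V : ℕ → Ω → ℝ × ℝ) (G : ℝ≥0 → Ω → ℝ)
    (lam p : ℝ → ℝ) (μ : Measure (ℝ × ℝ)) : Prop where
  lam_nonneg : ∀ x, 0 ≤ x → 0 ≤ lam x
  lam_integrable : ∀ t : ℝ, 0 ≤ t → IntervalIntegrable lam volume 0 t
  p_measurable : Measurable p
  p_mem : ∀ x, 0 ≤ x → p x ∈ Set.Icc (0 : ℝ) 1
  poisson : IsPoissonProcess P N lam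
  V_measurable : ∀ i, Measurable (V i)
  V_law : ∀ i, HasLaw (V i) μ P
  V_indep : iIndepFun V P
  V_nonneg : ∀ᵐ v ∂μ, 0 ≤ v.1 ∧ 0 ≤ v.2
  V_indep_N : IndepFun (fun ω i => V i ω) (fun ω t => N t ω) P
  G_measurable : ∀ t, Measurable (G t)
  G_nonneg : ∀ᵐ ω ∂P, ∀ t, 0 ≤ G t ω
  G_monotone : ∀ᵐ ω ∂P, Monotone fun t => G t ω
  A_indep_G : IndepFun (fun ω t => compound N V t ω) (fun ω t => G t ω) P

/-- `φ_t(L) = E (F_{G_t}(L - A_t⁽²⁾) exp(-∫_0^t A_s⁽¹⁾ ds) ∏_{i ≤ N_t} q(T_i))`, where `q = 1 - p`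
and `F_{G_t}` is the distribution function of `G_t`. -/
def phi (P : Measure Ω) (N : ℝ≥0 → Ω → ℕ) (V : ℕ → Ω → ℝ × ℝ) (G : ℝ≥0 → Ω → ℝ) (p : ℝ → ℝ)
    (t : ℝ≥0) (L : ℝ) : ℝ :=
  ∫ ω, cdf (P.map (G t)) (L - (compound N V t ω).2)
      * Real.exp (-∫ s in (0 : ℝ)..t, (compound N V s.toNNReal ω).1)
      * ∏ i ∈ Finset.range (N t ω), (1 - p (arrival N i ω)) ∂P

/-- Laplace transform `∫_0^∞ e^{-sx} f(x) dx` of a nonnegative function, with values in `[0, ∞]`. -/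
def laplaceFun (f : ℝ → ℝ) (s : ℝ) : ℝ≥0∞ :=
  ∫⁻ x in Set.Ici (0 : ℝ), ENNReal.ofReal (Real.exp (-(s * x)) * f x)

/-- Laplace transform `∫_{[0, ∞)} e^{-sx} ν(dx)` of a finite measure. -/
def laplaceMeasure (ν : Measure ℝ) (s : ℝ) : ℝ :=
  ∫ x in Set.Ici (0 : ℝ), Real.exp (-(s * x)) ∂ν

/-- Bivariate Laplace transform `∬_{[0, ∞)²} e^{-u v₁ - s v₂} μ(dv₁, dv₂)`. -/
def laplaceMeasure₂ (μ : Measure (ℝ × ℝ)) (u s : ℝ) : ℝ :=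
  ∫ v in Set.Ici (0 : ℝ) ×ˢ Set.Ici (0 : ℝ), Real.exp (-(u * v.1) - s * v.2) ∂μ

/-- Convolution `∫_0^t f(z) g(t - z) dz` of functions on `[0, ∞)`. -/
def convFun (f g : ℝ → ℝ) (t : ℝ) : ℝ :=
  ∫ z in (0 : ℝ)..t, f z * g (t - z)

/-- Convolution `∫_{[0, L]} F(L - x) ν(dx)` of a function with a measure on `[0, ∞)`. -/
def convMeasure (F : ℝ → ℝ) (ν : Measure ℝ) (L : ℝ) : ℝ :=
  ∫ x in Set.Icc 0 L, F (L - x) ∂ν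

/-- The cumulated intensity `Λ(t) = ∫_0^t lam`. -/
def cumIntensity (lam : ℝ → ℝ) (t : ℝ) : ℝ :=
  ∫ x in (0 : ℝ)..t, lam x

/-- The function `(qλ)(x) = q(x) λ(x)`, `q = 1 - p`. -/
def qlam (lam p : ℝ → ℝ) (x : ℝ) : ℝ :=
  (1 - p x) * lam x

/-- `exp(-Λ(t) + ((qλ) * μ̃(·, s))(t))`. -/
def nuTilde (lam p : ℝ → ℝ) (μ : Measure (ℝ × ℝ)) (t s : ℝ) : ℝ :=
  Real.exp (-cumIntensity lam t + convFun (qlam lam p) (fun u => laplaceMeasure₂ μ u s) t)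

/-- `a(t) = (μ̃₁ * (qλ))(t)`, with `μ₁` the first marginal of `μ`. -/
def aFun (lam p : ℝ → ℝ) (μ : Measure (ℝ × ℝ)) (t : ℝ) : ℝ :=
  convFun (laplaceMeasure (μ.map Prod.fst)) (qlam lam p) t

/-- `ν` is a finite measure carried by `[0, ∞)` whose Laplace transform is `f` on `[0, ∞)`. -/
structure HasLaplaceTransform (ν : Measure ℝ) (f : ℝ → ℝ) : Prop where
  finite : IsFiniteMeasure ν
  support : ν (Set.Iio 0) = 0
  eq : ∀ s, 0 ≤ s → laplaceMeasure ν s = f s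

end ShockModel

end

/-!
The measure `ν_t` is the law of `A_t⁽²⁾` once each path is weighted by
`exp (-∫_0^t A_s⁽¹⁾ ds) * ∏ q(T_i)`, and integrating `F_{G_t}(L - x)` against it gives `φ_t(L)`.
Since `∫_0^t A_s⁽¹⁾ ds = ∑ V_i⁽¹⁾ (t - T_i)`, the Laplace transform of `ν_t` is the expectation of a
product over the marked points `(T_i, V_i)`. Averaging over the marks first leaves the generating
functional `E ∏ h(T_i) = exp (∫_0^t (h - 1) λ)` of the Poisson process: for `h` constant on the
cells of a grid it is the independence of the increments, for continuous `h` one refines the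
grid, and a measurable `h` is an a.e. limit of continuous functions with respect to Lebesgue
measure and the laws of all the `T_i` simultaneously. Uniqueness of `ν_t` is Stone–Weierstrass
for polynomials in `e^{-x}`.
-/

namespace ShockModel

open Filter Topology

open BoundedContinuousFunction in
theorem ext_of_forall_integral_pow_eq {E : Type*} [TopologicalSpace E] [PolishSpace E]
    [MeasurableSpace E] [BorelSpace E] {ν₁ ν₂ : Measure E} [IsFiniteMeasure ν₁]
    [IsFiniteMeasure ν₂] (b : E →ᵇ ℝ) (hb : Function.Injective b)
    (h : ∀ k : ℕ, ∫ x, b x ^ k ∂ν₁ = ∫ x, b x ^ k ∂ν₂) : ν₁ = ν₂ := by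
  let A : StarSubalgebra ℝ (E →ᵇ ℝ) :=
    { Algebra.adjoin ℝ {b} with
      star_mem' := fun {g} hg => by rwa [show star g = g from ext fun x => star_trivial (g x)] }
  refine ext_of_forall_mem_subalgebra_integral_eq_of_polish (𝕜 := ℝ) (A := A) ?_ ?_
  · intro x y hxy
    exact ⟨b, ⟨b.toContinuousMap, ⟨b, Algebra.self_mem_adjoin_singleton ℝ b, rfl⟩, rfl⟩, hb.ne hxy⟩
  · intro g (hg : g ∈ Algebra.adjoin ℝ {b})
    rw [Algebra.adjoin_singleton_eq_range_aeval] at hg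
    obtain ⟨q, rfl⟩ := hg
    have integral_aeval (ν : Measure E) [IsFiniteMeasure ν] : ∫ x, Polynomial.aeval b q x ∂ν
        = ∑ k ∈ Finset.range (q.natDegree + 1), q.coeff k * ∫ x, b x ^ k ∂ν := by
      simp only [Polynomial.aeval_eq_sum_range, coe_sum, Finset.sum_apply, coe_smul, smul_eq_mul]
      rw [integral_finsetSum _ fun k _ => ((b ^ k).integrable ν).const_mul _]
      simp only [integral_const_mul, coe_pow, Pi.pow_apply]
    exact (integral_aeval ν₁).trans (by simp only [h]; exact (integral_aeval ν₂).symm)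

lemma ae_nonneg_of_measure_Iio {ν : Measure ℝ} (h : ν (Set.Iio 0) = 0) : ∀ᵐ x ∂ν, 0 ≤ x := by
  simpa [ae_iff, Set.Iio_def] using h

lemma restrict_Ici_eq_self {ν : Measure ℝ} (h : ν (Set.Iio 0) = 0) :
    ν.restrict (Set.Ici 0) = ν :=
  Measure.restrict_eq_self_of_ae_mem (ae_nonneg_of_measure_Iio h)

lemma map_coe_map_toNNReal {ν : Measure ℝ} (h : ν (Set.Iio 0) = 0) :
    (ν.map Real.toNNReal).map ((↑) : ℝ≥0 → ℝ) = ν := by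
  rw [Measure.map_map measurable_coe_nnreal_real measurable_real_toNNReal]
  refine (Measure.map_congr ?_).trans Measure.map_id
  filter_upwards [ae_nonneg_of_measure_Iio h] with x hx using Real.coe_toNNReal x hx

open BoundedContinuousFunction in
theorem HasLaplaceTransform.unique {ν₁ ν₂ : Measure ℝ} {f : ℝ → ℝ}
    (h₁ : HasLaplaceTransform ν₁ f) (h₂ : HasLaplaceTransform ν₂ f) : ν₁ = ν₂ := by
  have := h₁.finite
  have := h₂.finite
  let b : ℝ≥0 →ᵇ ℝ := .ofNormedAddCommGroup (fun x => Real.exp (-x)) (by fun_prop) 1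
    fun x => by simp
  have hb : Function.Injective b := fun x y hxy => by simpa [b] using hxy
  have integral_pow {ν : Measure ℝ} (h : HasLaplaceTransform ν f) (k : ℕ) :
      ∫ x, b x ^ k ∂ν.map Real.toNNReal = f k := by
    rw [integral_map measurable_real_toNNReal.aemeasurable (by fun_prop), ← h.eq k k.cast_nonneg,
      laplaceMeasure, restrict_Ici_eq_self h.support]
    refine integral_congr_ae ?_
    filter_upwards [ae_nonneg_of_measure_Iio h.support] with x hx
    simp [b, ← Real.exp_nat_mul, hx]
  have hmap : ν₁.map Real.toNNReal = ν₂.map Real.toNNReal :=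
    ext_of_forall_integral_pow_eq b hb fun k => by rw [integral_pow h₁, integral_pow h₂]
  rw [← map_coe_map_toNNReal h₁.support, hmap, map_coe_map_toNNReal h₂.support]

lemma lintegral_lintegral_sub_mul {E : Type*} [AddGroup E] [MeasurableSpace E]
    [MeasurableAdd₂ E] [MeasurableNeg E] {ρ ν : Measure E} [ρ.IsAddRightInvariant] [SFinite ρ]
    [SFinite ν] {f g : E → ℝ≥0∞} (hf : Measurable f) (hg : Measurable g) :
    ∫⁻ y, ∫⁻ x, f (y - x) * g x ∂ν ∂ρ = (∫⁻ y, f y ∂ρ) * ∫⁻ x, g x ∂ν := by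
  rw [lintegral_lintegral_swap
    ((hf.comp measurable_sub).mul (hg.comp measurable_snd)).aemeasurable]
  have inner (x : E) : ∫⁻ y, f (y - x) * g x ∂ρ = (∫⁻ y, f y ∂ρ) * g x := by
    rw [← lintegral_sub_right_eq_self f x]
    exact lintegral_mul_const _ (hf.comp (measurable_sub_const x))
  simp_rw [inner, lintegral_const_mul _ hg]

lemma ofReal_laplaceMeasure (ν : Measure ℝ) [IsFiniteMeasure ν] {s : ℝ} (hs : 0 ≤ s) :
    ENNReal.ofReal (laplaceMeasure ν s)
      = ∫⁻ x in Set.Ici 0, ENNReal.ofReal (Real.exp (-(s * x))) ∂ν := by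
  refine ofReal_integral_eq_lintegral_ofReal (Integrable.of_bound (by fun_prop) 1 ?_)
    (ae_of_all _ fun x => Real.exp_nonneg _)
  filter_upwards [ae_restrict_mem measurableSet_Ici] with x hx
  simpa using mul_nonneg hs hx

theorem laplaceFun_convMeasure {F : ℝ → ℝ} (hF : Measurable F) (hF0 : ∀ x, 0 ≤ x → 0 ≤ F x)
    {ν : Measure ℝ} [IsFiniteMeasure ν]
    (hint : ∀ L, IntegrableOn (fun x => F (L - x)) (Set.Icc 0 L) ν) {s : ℝ} (hs : 0 ≤ s) :
    laplaceFun (convMeasure F ν) s = laplaceFun F s * ENNReal.ofReal (laplaceMeasure ν s) := by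
  let f := (Set.Ici (0 : ℝ)).indicator fun x => ENNReal.ofReal (Real.exp (-(s * x)) * F x)
  let g := (Set.Ici (0 : ℝ)).indicator fun x => ENNReal.ofReal (Real.exp (-(s * x)))
  have hf : Measurable f := Measurable.indicator (by fun_prop) measurableSet_Ici
  have hg : Measurable g := Measurable.indicator (by fun_prop) measurableSet_Ici
  have product (L x : ℝ) : f (L - x) * g x = (Set.Icc 0 L).indicator
      (fun x => ENNReal.ofReal (Real.exp (-(s * L)) * F (L - x))) x := by
    rcases lt_or_ge x 0 with h0 | h0
    · simp [g, h0.not_ge]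
    rcases lt_or_ge L x with hL | hL
    · simp [f, hL.not_ge]
    simp only [f, g, Set.indicator, Set.mem_Ici, Set.mem_Icc, sub_nonneg, h0, hL, and_self, if_true]
    rw [← ENNReal.ofReal_mul (mul_nonneg (Real.exp_nonneg _) (hF0 _ (sub_nonneg.2 hL))),
      mul_right_comm, ← Real.exp_add]
    ring_nf
  have ofReal_conv (L : ℝ) : ENNReal.ofReal (Real.exp (-(s * L)) * convMeasure F ν L)
      = ∫⁻ x, f (L - x) * g x ∂ν := by
    simp_rw [product]
    rw [lintegral_indicator measurableSet_Icc, convMeasure, ← integral_const_mul,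
      ofReal_integral_eq_lintegral_ofReal ((hint L).const_mul _)]
    filter_upwards [ae_restrict_mem measurableSet_Icc] with x hx
      using mul_nonneg (Real.exp_nonneg _) (hF0 _ (sub_nonneg.2 hx.2))
  have conv_neg (L : ℝ) (hL : L ∉ Set.Ici (0 : ℝ)) : ∫⁻ x, f (L - x) * g x ∂ν = 0 := by
    simp [product, Set.Icc_eq_empty (show ¬0 ≤ L from hL)]
  calc laplaceFun (convMeasure F ν) s
      = ∫⁻ L, ∫⁻ x, f (L - x) * g x ∂ν := by
        simp_rw [laplaceFun, ofReal_conv]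
        exact setLIntegral_eq_of_support_subset (Function.support_subset_iff'.2 conv_neg)
    _ = laplaceFun F s * ENNReal.ofReal (laplaceMeasure ν s) := by
        rw [lintegral_lintegral_sub_mul hf hg, lintegral_indicator measurableSet_Ici,
          lintegral_indicator measurableSet_Ici, laplaceFun, ofReal_laplaceMeasure ν hs]

lemma convMeasure_eq_integral {F : ℝ → ℝ} (hF : ∀ x < 0, F x = 0) {ν : Measure ℝ}
    (hν : ν (Set.Iio 0) = 0) (L : ℝ) : convMeasure F ν L = ∫ x, F (L - x) ∂ν := by
  rw [convMeasure, ← integral_indicator measurableSet_Icc]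
  refine integral_congr_ae ?_
  filter_upwards [ae_nonneg_of_measure_Iio hν] with x hx
  by_cases hL : x ≤ L
  · simp [hx, hL]
  · simp [hL, hF (L - x) (sub_neg.2 (not_le.1 hL))]

lemma convFun_comm (f g : ℝ → ℝ) (t : ℝ) : convFun f g t = convFun g f t := by
  have h := intervalIntegral.integral_comp_sub_left (a := 0) (b := t) (fun z => f z * g (t - z)) t
  simp only [sub_self, sub_zero, sub_sub_cancel] at h
  simp_rw [convFun, ← h, mul_comm (f _)]

lemma laplaceMeasure₂_eq_mul {μ : Measure (ℝ × ℝ)}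
    (h : IndepFun (Prod.fst : ℝ × ℝ → ℝ) Prod.snd μ) (u s : ℝ) :
    laplaceMeasure₂ μ u s
      = laplaceMeasure (μ.map Prod.fst) u * laplaceMeasure (μ.map Prod.snd) s := by
  let e (c : ℝ) := (Set.Ici (0 : ℝ)).indicator fun x => Real.exp (-(c * x))
  have he (c : ℝ) : Measurable (e c) := Measurable.indicator (by fun_prop) measurableSet_Ici
  have laplace_map {X : ℝ × ℝ → ℝ} (hX : Measurable X) (c : ℝ) :
      laplaceMeasure (μ.map X) c = ∫ v, e c (X v) ∂μ := by
    rw [laplaceMeasure, ← integral_indicator measurableSet_Ici,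
      integral_map hX.aemeasurable (he c).aestronglyMeasurable]
  calc laplaceMeasure₂ μ u s = ∫ v, e u v.1 * e s v.2 ∂μ := by
        rw [laplaceMeasure₂, ← integral_indicator (measurableSet_Ici.prod measurableSet_Ici)]
        refine integral_congr_ae (ae_of_all _ fun v => ?_)
        by_cases h1 : 0 ≤ v.1 <;> by_cases h2 : 0 ≤ v.2 <;>
          simp [e, Set.indicator, Prod.le_def, h1, h2, ← Real.exp_add, sub_eq_add_neg]
    _ = _ := by
        rw [laplace_map measurable_fst, laplace_map measurable_snd]
        exact (h.comp (he u) (he s)).integral_fun_mul_eq_mul_integral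
          ((he u).comp measurable_fst).aestronglyMeasurable
          ((he s).comp measurable_snd).aestronglyMeasurable

lemma nuTilde_eq_of_indepFun {μ : Measure (ℝ × ℝ)}
    (h : IndepFun (Prod.fst : ℝ × ℝ → ℝ) Prod.snd μ) (lam p : ℝ → ℝ) (t s : ℝ) :
    nuTilde lam p μ t s = Real.exp (-cumIntensity lam t
      + aFun lam p μ t * laplaceMeasure (μ.map Prod.snd) s) := by
  rw [nuTilde, aFun, convFun_comm (laplaceMeasure _)]
  simp only [convFun, laplaceMeasure₂_eq_mul h, ← mul_assoc, intervalIntegral.integral_mul_const]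

section Path

variable {Ω : Type*} {N : ℝ≥0 → Ω → ℕ} {ω : Ω} {s t : ℝ≥0} {i : ℕ}

lemma arrival_le_of_lt (h : i < N s ω) : arrival N i ω ≤ s :=
  csInf_le (OrderBot.bddBelow _) h

lemma exists_lt_apply_of_arrival_lt (hi : i < N t ω) (hs : arrival N i ω < s) :
    ∃ u < s, i < N u ω := by
  obtain ⟨u, hu, hus⟩ := exists_lt_of_csInf_lt (s := {u : ℝ≥0 | i + 1 ≤ N u ω}) ⟨t, hi⟩ hs
  exact ⟨u, hus, hu⟩

lemma lt_apply_arrival (hr : ∀ t, ContinuousWithinAt (fun u => N u ω) (Set.Ici t) t)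
    (hi : i < N t ω) : i < N (arrival N i ω) ω := by
  have constant_right : ∀ᶠ u in nhdsWithin (arrival N i ω) (Set.Ici (arrival N i ω)),
      N u ω = N (arrival N i ω) ω := by
    simpa only [ContinuousWithinAt, nhds_discrete, Filter.tendsto_pure] using hr (arrival N i ω)
  obtain ⟨s, hs, hsub⟩ := mem_nhdsGE_iff_exists_Ico_subset.1 constant_right
  obtain ⟨u, hus, hu⟩ := exists_lt_apply_of_arrival_lt hi hs
  rwa [← show N u ω = N (arrival N i ω) ω from hsub ⟨arrival_le_of_lt hu, hus⟩]

lemma arrival_le_iff (hm : Monotone fun t => N t ω)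
    (hr : ∀ t, ContinuousWithinAt (fun u => N u ω) (Set.Ici t) t) (hi : i < N t ω) :
    arrival N i ω ≤ s ↔ i < N s ω :=
  ⟨fun h => (lt_apply_arrival hr hi).trans_le (hm h), arrival_le_of_lt⟩

/-- The arrival time number `i + 1` of the path `n`, capped at `t`. Taking the infimum over a
countable dense set of times makes it a measurable function of the path. -/
noncomputable def cappedArrival (t : ℝ≥0) (i : ℕ) (n : ℝ≥0 → ℕ) : ℝ≥0 :=
  ⨅ k : ℕ, if i < n (TopologicalSpace.denseSeq ℝ≥0 k) then
    min (TopologicalSpace.denseSeq ℝ≥0 k) t else t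

lemma measurable_cappedArrival (t : ℝ≥0) (i : ℕ) : Measurable (cappedArrival t i) :=
  Measurable.iInf fun _ => Measurable.ite
    (measurableSet_lt measurable_const (measurable_pi_apply _)) measurable_const measurable_const

lemma cappedArrival_le (t : ℝ≥0) (i : ℕ) (n : ℝ≥0 → ℕ) : cappedArrival t i n ≤ t := by
  refine (ciInf_le (OrderBot.bddBelow _) 0).trans ?_
  split_ifs <;> simp

lemma cappedArrival_eq_arrival (hm : Monotone fun t => N t ω) (hi : i < N t ω) :
    cappedArrival t i (fun s => N s ω) = arrival N i ω := by
  have hle : arrival N i ω ≤ t := arrival_le_of_lt hi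
  refine le_antisymm (le_of_forall_gt fun c hc => ?_) (le_ciInf fun k => ?_)
  · obtain ⟨u, huc, hu⟩ := exists_lt_apply_of_arrival_lt hi hc
    obtain ⟨k, huk, hkc⟩ := (TopologicalSpace.denseRange_denseSeq ℝ≥0).exists_mem_open
      isOpen_Ioo (Set.nonempty_Ioo.2 huc)
    refine (ciInf_le (OrderBot.bddBelow _) k).trans_lt ?_
    rw [if_pos (hu.trans_le (hm huk.le))]
    exact (min_le_left _ _).trans_lt hkc
  · split_ifs with hk
    · exact le_min (arrival_le_of_lt hk) hle
    · exact hle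

lemma intervalIntegral_indicator_Ici_const {a b c : ℝ} (hab : a ≤ b) (hbc : b ≤ c) (y : ℝ) :
    ∫ x in a..c, (Set.Ici b).indicator (fun _ => y) x = y * (c - b) := by
  rw [intervalIntegral.integral_of_le (hab.trans hbc), integral_indicator_const _ measurableSet_Ici,
    measureReal_congr Ioi_ae_eq_Ici.symm, measureReal_restrict_apply measurableSet_Ioi,
    Set.inter_comm, Set.Ioc_inter_Ioi, max_eq_right hab, Real.volume_real_Ioc_of_le hbc,
    smul_eq_mul, mul_comm]

lemma integral_sum_range_eq (hm : Monotone fun t => N t ω)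
    (hr : ∀ t, ContinuousWithinAt (fun u => N u ω) (Set.Ici t) t) (U : ℕ → ℝ) (t : ℝ≥0) :
    ∫ s in (0 : ℝ)..t, ∑ k ∈ Finset.range (N s.toNNReal ω), U k
      = ∑ k ∈ Finset.range (N t ω), U k * (t - arrival N k ω) := by
  have sum_eq (s : ℝ) (hs : s ∈ Set.uIcc (0 : ℝ) t) : ∑ k ∈ Finset.range (N s.toNNReal ω), U k
      = ∑ k ∈ Finset.range (N t ω),
          (Set.Ici (arrival N k ω : ℝ)).indicator (fun _ => U k) s := by
    rw [Set.uIcc_of_le t.coe_nonneg] at hs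
    have hst : N s.toNNReal ω ≤ N t ω := hm (Real.toNNReal_le_iff_le_coe.2 hs.2)
    rw [← Finset.sum_subset (Finset.range_subset_range.2 hst)]
    · refine Finset.sum_congr rfl fun k hk => ?_
      have : arrival N k ω ≤ s.toNNReal := arrival_le_of_lt (Finset.mem_range.1 hk)
      simp [(Real.le_toNNReal_iff_coe_le hs.1).1 this]
    · intro k hkt hks
      rw [Finset.mem_range] at hkt hks
      have : ¬arrival N k ω ≤ s.toNNReal := (arrival_le_iff hm hr hkt).not.2 hks
      simp [(Real.le_toNNReal_iff_coe_le hs.1).not.1 this]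
  rw [intervalIntegral.integral_congr sum_eq, intervalIntegral.integral_finsetSum]
  · refine Finset.sum_congr rfl fun k hk =>
      intervalIntegral_indicator_Ici_const (NNReal.coe_nonneg _) ?_ _
    exact_mod_cast arrival_le_of_lt (Finset.mem_range.1 hk)
  · intro k _
    rw [intervalIntegrable_iff]
    exact (integrableOn_const (by simp)).indicator measurableSet_Ici

end Path

section GeneratingFunctional

lemma integral_pow_poissonMeasure (r : ℝ≥0) (z : ℝ) :
    ∫ n, z ^ n ∂(poissonMeasure r) = Real.exp ((z - 1) * r) := by
  have h := (NormedSpace.expSeries_div_hasSum_exp ((r : ℝ) * z)).mul_left (Real.exp (-r))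
  rw [← Real.exp_eq_exp_ℝ, ← Real.exp_add] at h
  rw [integral_poissonMeasure, show (z - 1) * r = -(r : ℝ) + r * z by ring, ← h.tsum_eq]
  refine tsum_congr fun n => ?_
  rw [smul_eq_mul, mul_pow]
  ring

@[to_additive]
lemma measurable_prod_range {Ω : Type*} [MeasurableSpace Ω] {M : Type*} [CommMonoid M]
    [MeasurableSpace M] [MeasurableMul₂ M] {X : Ω → ℕ} (hX : Measurable X) {f : ℕ → Ω → M}
    (hf : ∀ i, Measurable (f i)) : Measurable fun ω => ∏ i ∈ Finset.range (X ω), f i ω := by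
  have : Measurable fun z : Ω × ℕ => ∏ i ∈ Finset.range z.2, f i z.1 :=
    measurable_from_prod_countable_left fun n =>
      Finset.measurable_fun_prod (Finset.range n) fun i _ => hf i
  exact this.comp (measurable_id.prodMk hX)

/-- `lam` is an admissible intensity: nonnegative and locally integrable on `[0, ∞)`. -/
structure IsIntensity (lam : ℝ → ℝ) : Prop where
  nonneg : ∀ x, 0 ≤ x → 0 ≤ lam x
  integrable : ∀ t : ℝ, 0 ≤ t → IntervalIntegrable lam volume 0 t

variable {Ω : Type*} {N : ℝ≥0 → Ω → ℕ}

lemma prod_arrival_eq_prod_pow_increments {ω : Ω} (hm : Monotone fun t => N t ω)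
    (hr : ∀ t, ContinuousWithinAt (fun u => N u ω) (Set.Ici t) t) (hz : N 0 ω = 0)
    {u : ℕ → ℝ≥0} (hu : Monotone u) (hu0 : u 0 = 0) {M : Type*} [CommMonoid M] {h : ℝ≥0 → M}
    {c : ℕ → M} (n : ℕ) (hc : ∀ k < n, ∀ x ∈ Set.Ioc (u k) (u (k + 1)), h x = c k) :
    ∏ i ∈ Finset.range (N (u n) ω), h (arrival N i ω)
      = ∏ k ∈ Finset.range n, c k ^ (N (u (k + 1)) ω - N (u k) ω) := by
  induction n with
  | zero => simp [hu0, hz]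
  | succ n ih =>
    rw [Finset.prod_range_succ, ← ih fun k hk => hc k (hk.trans n.lt_succ_self),
      ← Finset.prod_range_mul_prod_Ico _ (hm (hu n.le_succ)), ← Nat.card_Ico,
      Finset.prod_eq_pow_card (s := Finset.Ico _ _)]
    intro i hi
    rw [Finset.mem_Ico] at hi
    refine hc n n.lt_succ_self _ ⟨?_, arrival_le_of_lt hi.2⟩
    rw [← not_le, arrival_le_iff hm hr hi.2, not_lt]
    exact hi.1

lemma sum_integral_step {lam : ℝ → ℝ} (hlam : IsIntensity lam) {u : ℕ → ℝ≥0} (hu : Monotone u)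
    (hu0 : u 0 = 0) {h : ℝ → ℝ} {c : ℕ → ℝ} (n : ℕ)
    (hc : ∀ k < n, ∀ x ∈ Set.Ioc (u k : ℝ) (u (k + 1)), h x = c k) :
    ∑ k ∈ Finset.range n, c k * ∫ x in (u k : ℝ)..(u (k + 1)), lam x
      = ∫ x in (0 : ℝ)..u n, h x * lam x := by
  have hle (k : ℕ) : (u k : ℝ) ≤ u (k + 1) := hu k.le_succ
  have cell {k : ℕ} (hk : k < n) : Set.EqOn (fun x => c k * lam x) (fun x => h x * lam x)
      (Set.uIoc (u k : ℝ) (u (k + 1))) := by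
    intro x hx
    rw [Set.uIoc_of_le (hle k)] at hx
    simp only [hc k hk x hx]
  have integrable_cell (k : ℕ) (hk : k < n) :
      IntervalIntegrable (fun x => h x * lam x) volume (u k) (u (k + 1)) :=
    (((hlam.integrable _ (u k).coe_nonneg).symm.trans
      (hlam.integrable _ (u (k + 1)).coe_nonneg)).const_mul (c k)).congr (cell hk)
  rw [← NNReal.coe_zero, ← hu0, ← intervalIntegral.sum_integral_adjacent_intervals integrable_cell]
  refine Finset.sum_congr rfl fun k hk => ?_
  rw [← intervalIntegral.integral_const_mul]
  exact intervalIntegral.integral_congr_ae (ae_of_all _ (cell (Finset.mem_range.1 hk)))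

variable [MeasurableSpace Ω] {P : Measure Ω} {lam : ℝ → ℝ}

lemma IsPoissonProcess.integral_prod_pow_increments (hN : IsPoissonProcess P N lam)
    (hlam : IsIntensity lam) {u : ℕ → ℝ≥0} (hu : Monotone u) (c : ℕ → ℝ) (n : ℕ) :
    ∫ ω, ∏ k ∈ Finset.range n, c k ^ (N (u (k + 1)) ω - N (u k) ω) ∂P
      = Real.exp (∑ k ∈ Finset.range n, (c k - 1) * ∫ x in (u k : ℝ)..(u (k + 1)), lam x) := by
  have hind : iIndepFun (fun (k : Fin n) ω => N (u (k + 1)) ω - N (u k) ω) P :=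
    (hN.indepIncrements.nat hu).precomp Fin.val_injective
  have integral_prod := hind.integral_fun_prod_comp (f := fun (k : Fin n) (m : ℕ) => c k ^ m)
    (fun k => ((hN.measurable _).sub (hN.measurable _)).aemeasurable)
    (fun k => Measurable.of_discrete.aestronglyMeasurable)
  simp_rw [Finset.prod_range, integral_prod, Real.exp_sum, Finset.prod_range]
  refine Finset.prod_congr rfl fun k _ => ?_
  have hle : u k ≤ u (k + 1) := hu (Nat.le_succ _)
  have hlaw := hN.law _ _ hle
  rw [← integral_map (f := fun m : ℕ => c k ^ m) hlaw.aemeasurable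
    Measurable.of_discrete.aestronglyMeasurable, hlaw.map_eq, integral_pow_poissonMeasure,
    Real.coe_toNNReal]
  exact intervalIntegral.integral_nonneg hle
    fun x hx => hlam.nonneg x ((NNReal.coe_nonneg _).trans hx.1)

lemma IsPoissonProcess.integral_prod_arrival_of_step (hN : IsPoissonProcess P N lam)
    (hlam : IsIntensity lam) {u : ℕ → ℝ≥0} (hu : Monotone u) (hu0 : u 0 = 0) {h : ℝ → ℝ}
    {c : ℕ → ℝ} (n : ℕ) (hc : ∀ k < n, ∀ x ∈ Set.Ioc (u k : ℝ) (u (k + 1)), h x = c k) :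
    ∫ ω, ∏ i ∈ Finset.range (N (u n) ω), h (arrival N i ω) ∂P
      = Real.exp (∫ x in (0 : ℝ)..u n, (h x - 1) * lam x) := by
  rw [← sum_integral_step hlam hu hu0 (h := fun x => h x - 1) (c := fun k => c k - 1) n
      fun k hk x hx => by rw [hc k hk x hx],
    ← hN.integral_prod_pow_increments hlam hu]
  refine integral_congr_ae ?_
  filter_upwards [hN.monotone, hN.rightCont, hN.zero] with ω hm hr hz
  exact prod_arrival_eq_prod_pow_increments hm hr hz hu hu0 (h := fun x => h x) n
    fun k hk x hx => hc k hk x hx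

lemma IsPoissonProcess.ae_cappedArrival_eq_arrival (hN : IsPoissonProcess P N lam) (t : ℝ≥0) :
    ∀ᵐ ω ∂P, ∀ i < N t ω, cappedArrival t i (fun s => N s ω) = arrival N i ω := by
  filter_upwards [hN.monotone] with ω hm i hi using cappedArrival_eq_arrival hm hi

lemma IsPoissonProcess.measurable_cappedArrival (hN : IsPoissonProcess P N lam) (t : ℝ≥0) (i : ℕ) :
    Measurable fun ω => cappedArrival t i fun s => N s ω :=
  (ShockModel.measurable_cappedArrival t i).comp (measurable_pi_lambda _ hN.measurable)

lemma IsPoissonProcess.aemeasurable_prod_arrival (hN : IsPoissonProcess P N lam) (t : ℝ≥0)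
    {M : Type*} [CommMonoid M] [MeasurableSpace M] [MeasurableMul₂ M] {k : ℕ → ℝ × Ω → M}
    (hk : ∀ i, Measurable (k i)) :
    AEMeasurable (fun ω => ∏ i ∈ Finset.range (N t ω), k i (arrival N i ω, ω)) P := by
  refine ⟨fun ω => ∏ i ∈ Finset.range (N t ω), k i (cappedArrival t i (fun s => N s ω), ω),
    measurable_prod_range (hN.measurable t) fun i => (hk i).comp
      ((hN.measurable_cappedArrival t i).coe_nnreal_real.prodMk measurable_id), ?_⟩
  filter_upwards [hN.ae_cappedArrival_eq_arrival t] with ω hω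
  exact Finset.prod_congr rfl fun i hi => by rw [hω i (Finset.mem_range.1 hi)]

lemma IsPoissonProcess.integral_prod_arrival_of_tendsto [IsProbabilityMeasure P]
    (hN : IsPoissonProcess P N lam) (hlam : IsIntensity lam) (t : ℝ≥0) {g : ℕ → ℝ → ℝ} {h : ℝ → ℝ}
    (hg : ∀ n, Measurable (g n)) (hg1 : ∀ n x, |g n x| ≤ 1)
    (hvol : ∀ᵐ x, x ∈ Set.Ioc (0 : ℝ) t →
      Tendsto (fun n => g n x) atTop (𝓝 (h x)))
    (hpath : ∀ᵐ ω ∂P, ∀ i < N t ω, Tendsto (fun n => g n (arrival N i ω)) atTop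
      (𝓝 (h (arrival N i ω))))
    (heq : ∀ n, ∫ ω, ∏ i ∈ Finset.range (N t ω), g n (arrival N i ω) ∂P
      = Real.exp (∫ x in (0 : ℝ)..t, (g n x - 1) * lam x)) :
    ∫ ω, ∏ i ∈ Finset.range (N t ω), h (arrival N i ω) ∂P
      = Real.exp (∫ x in (0 : ℝ)..t, (h x - 1) * lam x) := by
  have hIoc : Set.uIoc (0 : ℝ) t = Set.Ioc 0 (t : ℝ) := Set.uIoc_of_le t.coe_nonneg
  have left : Tendsto (fun n => ∫ ω, ∏ i ∈ Finset.range (N t ω), g n (arrival N i ω) ∂P)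
      atTop (𝓝 (∫ ω, ∏ i ∈ Finset.range (N t ω), h (arrival N i ω) ∂P)) := by
    refine tendsto_integral_of_dominated_convergence 1
      (fun n => (hN.aemeasurable_prod_arrival t
        fun _ => (hg n).comp measurable_fst).aestronglyMeasurable)
      (integrable_const 1) (fun n => ae_of_all _ fun ω => ?_) ?_
    · rw [Real.norm_eq_abs, Finset.abs_prod]
      exact Finset.prod_le_one (fun _ _ => abs_nonneg _) fun _ _ => hg1 n _
    · filter_upwards [hpath] with ω hω
      exact tendsto_finsetProd _ fun i hi => hω i (Finset.mem_range.1 hi)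
  have right : Tendsto (fun n => ∫ x in (0 : ℝ)..t, (g n x - 1) * lam x) atTop
      (𝓝 (∫ x in (0 : ℝ)..t, (h x - 1) * lam x)) := by
    have hlam_t := hlam.integrable t t.coe_nonneg
    refine intervalIntegral.tendsto_integral_filter_of_dominated_convergence
      (fun x => 2 * ‖lam x‖) (.of_forall fun n => ?_)
      (.of_forall fun n => ae_of_all _ fun x _ => ?_) (hlam_t.norm.const_mul 2) ?_
    · exact ((hg n).sub_const 1).aestronglyMeasurable.mul hlam_t.def'.aestronglyMeasurable
    · rw [norm_mul, Real.norm_eq_abs]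
      gcongr
      exact (abs_sub _ _).trans (by linarith [hg1 n x, abs_one (α := ℝ)])
    · filter_upwards [hvol] with x hx hxt
      exact ((hx (hIoc ▸ hxt)).sub_const 1).mul_const _
  simp_rw [heq] at left
  exact tendsto_nhds_unique left ((Real.continuous_exp.tendsto _).comp right)

lemma exists_continuous_tendsto_ae {α : Type*} [PseudoEMetricSpace α] [MeasurableSpace α]
    [BorelSpace α] {κ : Measure α} [SFinite κ] {f : α → ℝ} (hf : Measurable f) {a b : ℝ}
    (hab : a ≤ b) (hfab : ∀ᵐ x ∂κ, f x ∈ Set.Icc a b) :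
    ∃ g : ℕ → α → ℝ, (∀ n, Continuous (g n)) ∧ (∀ n x, g n x ∈ Set.Icc a b) ∧
      ∀ᵐ x ∂κ, Tendsto (fun n => g n x) atTop (𝓝 (f x)) := by
  rw [← ae_toFinite (μ := κ)] at hfab ⊢
  have hfL1 : MemLp f 1 κ.toFinite :=
    memLp_one_iff_integrable.2 (.of_mem_Icc a b hf.aemeasurable hfab)
  choose g hg hgL1 using fun n : ℕ => hfL1.exists_boundedContinuous_eLpNorm_sub_le
    ENNReal.one_ne_top (ENNReal.inv_ne_zero.2 (ENNReal.natCast_ne_top n))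
  have tendsto_L1 : Tendsto (fun n => eLpNorm (⇑(g n) - f) 1 κ.toFinite) atTop (𝓝 0) := by
    simp_rw [eLpNorm_sub_comm _ f]
    exact tendsto_of_tendsto_of_tendsto_of_le_of_le tendsto_const_nhds
      ENNReal.tendsto_inv_nat_nhds_zero (fun _ => zero_le) hg
  obtain ⟨ns, -, hns⟩ := (tendstoInMeasure_of_tendsto_eLpNorm one_ne_zero
    (fun n => (hgL1 n).aestronglyMeasurable) hfL1.aestronglyMeasurable
    tendsto_L1).exists_seq_tendsto_ae
  refine ⟨fun n x => Set.projIcc a b hab (g (ns n) x),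
    fun n => continuous_subtype_val.comp (continuous_projIcc.comp (g (ns n)).continuous),
    fun n x => Subtype.coe_prop _, ?_⟩
  filter_upwards [hfab, hns] with x hx hgx
  have hproj :=
    ((continuous_subtype_val.comp (continuous_projIcc (h := hab))).tendsto (f x)).comp hgx
  simpa only [Function.comp_def, Set.projIcc_of_mem hab hx] using hproj

/-- The smallest point of the grid `δℕ` that is at least `x`. -/
noncomputable def gridCeil (δ x : ℝ) : ℝ :=
  ⌈x / δ⌉₊ * δ

lemma measurable_gridCeil (δ : ℝ) : Measurable (gridCeil δ) := by
  unfold gridCeil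
  fun_prop

lemma gridCeil_eq_of_mem_Ioc {δ x : ℝ} (hδ : 0 < δ) {k : ℕ}
    (hx : x ∈ Set.Ioc (k * δ) ((k + 1 : ℕ) * δ)) : gridCeil δ x = (k + 1 : ℕ) * δ := by
  rw [gridCeil, (Nat.ceil_eq_iff k.succ_ne_zero).2 ⟨?_, (div_le_iff₀ hδ).2 hx.2⟩]
  simpa using (lt_div_iff₀ hδ).2 hx.1

lemma gridCeil_mem_Icc {δ x : ℝ} (hδ : 0 < δ) (hx : 0 ≤ x) :
    gridCeil δ x ∈ Set.Icc x (x + δ) := by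
  refine ⟨(div_le_iff₀ hδ).1 (Nat.le_ceil _), ?_⟩
  calc gridCeil δ x ≤ (x / δ + 1) * δ := by
        unfold gridCeil
        gcongr
        exact (Nat.ceil_lt_add_one (by positivity)).le
    _ = x + δ := by field_simp

lemma tendsto_gridCeil {δ : ℕ → ℝ} (hδ : ∀ n, 0 < δ n) (hδ0 : Tendsto δ atTop (𝓝 0)) {x : ℝ}
    (hx : 0 ≤ x) : Tendsto (fun n => gridCeil (δ n) x) atTop (𝓝 x) :=
  tendsto_of_tendsto_of_tendsto_of_le_of_le tendsto_const_nhds (by simpa using hδ0.const_add x)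
    (fun n => (gridCeil_mem_Icc (hδ n) hx).1) fun n => (gridCeil_mem_Icc (hδ n) hx).2

lemma IsPoissonProcess.integral_prod_arrival_of_continuous [IsProbabilityMeasure P]
    (hN : IsPoissonProcess P N lam) (hlam : IsIntensity lam) (t : ℝ≥0) {h : ℝ → ℝ}
    (hh : Continuous h) (hh1 : ∀ x, |h x| ≤ 1) :
    ∫ ω, ∏ i ∈ Finset.range (N t ω), h (arrival N i ω) ∂P
      = Real.exp (∫ x in (0 : ℝ)..t, (h x - 1) * lam x) := by
  rcases eq_zero_or_pos t with rfl | ht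
  · simpa using hN.integral_prod_arrival_of_step hlam monotone_const (u := 0) rfl (h := h)
      (c := 0) 0 (by simp)
  let δ (n : ℕ) : ℝ≥0 := t / (n + 1)
  have hδ (n : ℕ) : 0 < δ n := by positivity
  have hδ0 : Tendsto (fun n => (δ n : ℝ)) atTop (𝓝 0) := by
    simpa [δ, div_eq_mul_inv] using
      (tendsto_one_div_add_atTop_nhds_zero_nat (𝕜 := ℝ)).const_mul (t : ℝ)
  have tendsto_comp (x : ℝ) (hx : 0 ≤ x) :
      Tendsto (fun n => h (gridCeil (δ n) x)) atTop (𝓝 (h x)) :=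
    (hh.tendsto x).comp (tendsto_gridCeil hδ hδ0 hx)
  refine hN.integral_prod_arrival_of_tendsto hlam t (g := fun n x => h (gridCeil (δ n) x))
    (fun n => hh.measurable.comp (measurable_gridCeil _)) (fun n x => hh1 _)
    (ae_of_all _ fun x hx => tendsto_comp x hx.1.le)
    (ae_of_all _ fun ω i _ => tendsto_comp _ (NNReal.coe_nonneg _)) fun n => ?_
  have grid_end : ((n + 1 : ℕ) : ℝ≥0) * δ n = t := by
    simp only [δ]
    push_cast
    field_simp
  have step := hN.integral_prod_arrival_of_step hlam (u := fun k => k * δ n)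
    (fun i j hij => by dsimp only; gcongr) (by simp) (h := fun x => h (gridCeil (δ n) x))
    (c := fun k => h ((k + 1 : ℕ) * δ n)) (n + 1)
    fun k _ x hx => congrArg h (gridCeil_eq_of_mem_Ioc (hδ n) (by exact_mod_cast hx))
  rwa [grid_end] at step

theorem IsPoissonProcess.integral_prod_arrival [IsProbabilityMeasure P]
    (hN : IsPoissonProcess P N lam) (hlam : IsIntensity lam) (t : ℝ≥0) {h : ℝ → ℝ}
    (hh : Measurable h) (hh1 : ∀ x ∈ Set.Icc (0 : ℝ) t, |h x| ≤ 1) :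
    ∫ ω, ∏ i ∈ Finset.range (N t ω), h (arrival N i ω) ∂P
      = Real.exp (∫ x in (0 : ℝ)..t, (h x - 1) * lam x) := by
  let T (i : ℕ) (ω : Ω) : ℝ := cappedArrival t i fun s => N s ω
  have hT (i : ℕ) : Measurable (T i) := (hN.measurable_cappedArrival t i).coe_nnreal_real
  let κ : Measure ℝ := volume.restrict (Set.Ioc 0 (t : ℝ)) + Measure.sum fun i => P.map (T i)
  have ae_κ_iff {p : ℝ → Prop} (hp : MeasurableSet {x | p x}) : (∀ᵐ x ∂κ, p x) ↔
      (∀ᵐ x, x ∈ Set.Ioc (0 : ℝ) t → p x) ∧ ∀ i, ∀ᵐ ω ∂P, p (T i ω) := by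
    simp_rw [κ, ae_add_measure_iff, Measure.ae_sum_iff' hp, ae_restrict_iff' measurableSet_Ioc,
      ae_map_iff (hT _).aemeasurable hp]
  have hκ : ∀ᵐ x ∂κ, h x ∈ Set.Icc (-1 : ℝ) 1 := by
    refine (ae_κ_iff (hh measurableSet_Icc)).2 ⟨?_, fun i => ?_⟩
    · exact ae_of_all _ fun x hx => abs_le.1 (hh1 x ⟨hx.1.le, hx.2⟩)
    · exact ae_of_all _ fun ω => abs_le.1
        (hh1 _ ⟨NNReal.coe_nonneg _, NNReal.coe_le_coe.2 (cappedArrival_le _ _ _)⟩)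
  obtain ⟨g, hg, hg1, hlim⟩ := exists_continuous_tendsto_ae hh (by norm_num) hκ
  obtain ⟨hvol, hpath⟩ :=
    (ae_κ_iff (measurableSet_tendsto_fun (fun n => (hg n).measurable) hh)).1 hlim
  refine hN.integral_prod_arrival_of_tendsto hlam t (fun n => (hg n).measurable)
    (fun n x => abs_le.2 (hg1 n x)) hvol ?_
    fun n => hN.integral_prod_arrival_of_continuous hlam t (hg n) fun x => abs_le.2 (hg1 n x)
  filter_upwards [ae_all_iff.2 hpath, hN.ae_cappedArrival_eq_arrival t] with ω hω hT_eq i hi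
  simpa only [T, hT_eq i hi] using hω i

end GeneratingFunctional

section Marks

variable {Ω E F : Type*} [MeasurableSpace Ω] [MeasurableSpace E] [MeasurableSpace F]
  {P : Measure Ω} {V : ℕ → Ω → E} {μ : Measure E} {X : Ω → F}

/-- `V` is a sequence of marks for the random element `X`: i.i.d. with law `μ`, and independent
of `X`. The marked points of a counting process `N` are obtained with `X = (N_t)_t`. -/
structure IsMarking (P : Measure Ω) (V : ℕ → Ω → E) (μ : Measure E) (X : Ω → F) : Prop where
  measurable : ∀ i, Measurable (V i)
  law : ∀ i, HasLaw (V i) μ P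
  indep : iIndepFun V P
  indep_right : IndepFun (fun ω i => V i ω) X P

lemma IsMarking.lintegral_prod_comp [IsProbabilityMeasure P] (hV : IsMarking P V μ X)
    {f : ℕ → E → ℝ≥0∞} (hf : ∀ i, Measurable (f i)) (n : ℕ) :
    ∫⁻ ω, ∏ i ∈ Finset.range n, f i (V i ω) ∂P = ∏ i ∈ Finset.range n, ∫⁻ v, f i v ∂μ := by
  rw [lintegral_prod_eq_prod_lintegral_of_indepFun _ (fun i ω => f i (V i ω)) (hV.indep.comp f hf)
    fun i => (hf i).comp (hV.measurable i)]
  refine Finset.prod_congr rfl fun i _ => ?_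
  rw [← (hV.law i).map_eq, lintegral_map (hf i) (hV.measurable i)]

theorem IsMarking.lintegral_prod_range [IsProbabilityMeasure P] (hV : IsMarking P V μ X)
    (hX : Measurable X) {m : F → ℕ} (hm : Measurable m) {k : ℕ → F × E → ℝ≥0∞}
    (hk : ∀ i, Measurable (k i)) :
    ∫⁻ ω, ∏ i ∈ Finset.range (m (X ω)), k i (X ω, V i ω) ∂P
      = ∫⁻ ω, ∏ i ∈ Finset.range (m (X ω)), ∫⁻ v, k i (X ω, v) ∂μ ∂P := by
  have := (hV.law 0).isProbabilityMeasure_iff.1 inferInstance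
  have hVm : Measurable fun ω i => V i ω := measurable_pi_lambda _ hV.measurable
  have := Measure.isProbabilityMeasure_map (μ := P) hVm.aemeasurable
  have joint_law := (indepFun_iff_map_prod_eq_prod_map_map hVm.aemeasurable hX.aemeasurable).1
    hV.indep_right
  let Φ (v : ℕ → E) (x : F) : ℝ≥0∞ := ∏ i ∈ Finset.range (m x), k i (x, v i)
  have hΦ : Measurable (Function.uncurry Φ) :=
    measurable_prod_range (hm.comp measurable_snd) fun i => (hk i).comp
      (measurable_snd.prodMk ((measurable_pi_apply i).comp measurable_fst))
  have average (x : F) : ∫⁻ v, Φ v x ∂(P.map fun ω i => V i ω)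
      = ∏ i ∈ Finset.range (m x), ∫⁻ v, k i (x, v) ∂μ := by
    rw [lintegral_map (f := fun v => Φ v x) (hΦ.comp measurable_prodMk_right) hVm]
    exact hV.lintegral_prod_comp (fun i => (hk i).comp measurable_prodMk_left) (m x)
  calc ∫⁻ ω, Φ (fun i => V i ω) (X ω) ∂P
      = ∫⁻ z, Function.uncurry Φ z ∂(P.map fun ω => (fun i => V i ω, X ω)) :=
        (lintegral_map hΦ (hVm.prodMk hX)).symm
    _ = ∫⁻ x, ∏ i ∈ Finset.range (m x), ∫⁻ v, k i (x, v) ∂μ ∂(P.map X) := by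
        rw [joint_law, lintegral_prod_symm _ hΦ.aemeasurable]
        exact lintegral_congr average
    _ = _ := lintegral_map (measurable_prod_range hm fun i => (hk i).lintegral_prod_right') hX

variable {N : ℝ≥0 → Ω → ℕ} {lam : ℝ → ℝ}

lemma IsPoissonProcess.lintegral_prod_cappedArrival (hN : IsPoissonProcess P N lam) (t : ℝ≥0)
    (k : ℕ → ℝ × Ω → ℝ≥0∞) :
    ∫⁻ ω, ∏ i ∈ Finset.range (N t ω), k i (cappedArrival t i (fun s => N s ω), ω) ∂P
      = ∫⁻ ω, ∏ i ∈ Finset.range (N t ω), k i (arrival N i ω, ω) ∂P := by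
  refine lintegral_congr_ae ?_
  filter_upwards [hN.ae_cappedArrival_eq_arrival t] with ω hω
  exact Finset.prod_congr rfl fun i hi => by rw [hω i (Finset.mem_range.1 hi)]

lemma IsPoissonProcess.lintegral_prod_arrival [IsProbabilityMeasure P]
    (hN : IsPoissonProcess P N lam) (hlam : IsIntensity lam) (t : ℝ≥0) {h : ℝ → ℝ≥0∞}
    (hh : Measurable h) (hh1 : ∀ x ∈ Set.Icc (0 : ℝ) t, h x ≤ 1) :
    ∫⁻ ω, ∏ i ∈ Finset.range (N t ω), h (arrival N i ω) ∂P
      = ENNReal.ofReal (Real.exp (∫ x in (0 : ℝ)..t, ((h x).toReal - 1) * lam x)) := by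
  have prod_le_one (ω : Ω) : ∏ i ∈ Finset.range (N t ω), h (arrival N i ω) ≤ 1 :=
    Finset.prod_le_one' fun i hi =>
      hh1 _ ⟨NNReal.coe_nonneg _, arrival_le_of_lt (Finset.mem_range.1 hi)⟩
  have lintegral_le_one : ∫⁻ ω, ∏ i ∈ Finset.range (N t ω), h (arrival N i ω) ∂P ≤ 1 :=
    (lintegral_mono prod_le_one).trans (by simp)
  rw [← hN.integral_prod_arrival hlam t hh.ennreal_toReal fun x hx => by
    simpa using ENNReal.toReal_mono ENNReal.one_ne_top (hh1 x hx)]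
  simp_rw [← ENNReal.toReal_prod]
  rw [integral_toReal
      (hN.aemeasurable_prod_arrival t (k := fun _ z => h z.1) fun _ => hh.comp measurable_fst)
      (ae_of_all _ fun ω => (prod_le_one ω).trans_lt ENNReal.one_lt_top),
    ENNReal.ofReal_toReal (lintegral_le_one.trans_lt ENNReal.one_lt_top).ne]

theorem IsPoissonProcess.lintegral_prod_marks [IsProbabilityMeasure P]
    (hN : IsPoissonProcess P N lam) (hlam : IsIntensity lam)
    (hV : IsMarking P V μ fun ω t => N t ω) (t : ℝ≥0) {k : ℝ × E → ℝ≥0∞} (hk : Measurable k)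
    (hk1 : ∀ x ∈ Set.Icc (0 : ℝ) t, ∫⁻ v, k (x, v) ∂μ ≤ 1) :
    ∫⁻ ω, ∏ i ∈ Finset.range (N t ω), k (arrival N i ω, V i ω) ∂P
      = ENNReal.ofReal
          (Real.exp (∫ x in (0 : ℝ)..t, ((∫⁻ v, k (x, v) ∂μ).toReal - 1) * lam x)) := by
  have := (hV.law 0).isProbabilityMeasure_iff.1 inferInstance
  rw [← hN.lintegral_prod_arrival hlam t hk.lintegral_prod_right' hk1,
    ← hN.lintegral_prod_cappedArrival t fun i z => k (z.1, V i z.2),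
    ← hN.lintegral_prod_cappedArrival t fun _ z => ∫⁻ v, k (z.1, v) ∂μ]
  exact hV.lintegral_prod_range (measurable_pi_lambda _ hN.measurable) (measurable_pi_apply t)
    (k := fun i z => k (cappedArrival t i z.1, z.2)) fun i => hk.comp
      (((ShockModel.measurable_cappedArrival t i).coe_nnreal_real.comp measurable_fst).prodMk
        measurable_snd)

end Marks

section ShockMeasure

/-- `N` is a Poisson process of shocks with intensity `lam`, a shock at time `x` being fatal with
probability `p x`, and `V` is a marking of `N` by nonnegative increments with law `μ`: the standing
assumptions without the intrinsic deterioration. -/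
structure IsShockProcess {Ω : Type*} [MeasurableSpace Ω] (P : Measure Ω) (N : ℝ≥0 → Ω → ℕ)
    (V : ℕ → Ω → ℝ × ℝ) (lam p : ℝ → ℝ) (μ : Measure (ℝ × ℝ)) : Prop where
  intensity : IsIntensity lam
  poisson : IsPoissonProcess P N lam
  marking : IsMarking P V μ fun ω t => N t ω
  measurable_fatality : Measurable p
  fatality_mem : ∀ x, 0 ≤ x → p x ∈ Set.Icc (0 : ℝ) 1
  increment_nonneg : ∀ᵐ v ∂μ, 0 ≤ v.1 ∧ 0 ≤ v.2

/-- The weight `exp(-∫_0^t A_s⁽¹⁾ ds) ∏_{i ≤ N_t} q(T_i)` of a path in the definition of `φ_t`. -/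
noncomputable def shockWeight {Ω : Type*} (N : ℝ≥0 → Ω → ℕ) (V : ℕ → Ω → ℝ × ℝ) (p : ℝ → ℝ)
    (t : ℝ≥0) (ω : Ω) : ℝ :=
  Real.exp (-∫ s in (0 : ℝ)..t, (compound N V s.toNNReal ω).1)
    * ∏ i ∈ Finset.range (N t ω), (1 - p (arrival N i ω))

/-- The measure `ν_t`: the law of `A_t⁽²⁾` when the paths are weighted by `shockWeight`. -/
noncomputable def shockMeasure {Ω : Type*} [MeasurableSpace Ω] (P : Measure Ω) (N : ℝ≥0 → Ω → ℕ)
    (V : ℕ → Ω → ℝ × ℝ) (p : ℝ → ℝ) (t : ℝ≥0) : Measure ℝ :=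
  (P.withDensity fun ω => ENNReal.ofReal (shockWeight N V p t ω)).map
    fun ω => (compound N V t ω).2

/-- The factor contributed to `e^{-s A_t⁽²⁾} exp(-∫_0^t A_r⁽¹⁾ dr) ∏ q(T_i)` by a shock at time
`x` with increments `v`. -/
noncomputable def shockFactor (p : ℝ → ℝ) (t s x : ℝ) (v : ℝ × ℝ) : ℝ :=
  (1 - p x) * Real.exp (-((t - x) * v.1) - s * v.2)

variable {Ω : Type*} [MeasurableSpace Ω] {P : Measure Ω} {N : ℝ≥0 → Ω → ℕ}
  {V : ℕ → Ω → ℝ × ℝ} {lam p : ℝ → ℝ} {μ : Measure (ℝ × ℝ)}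

lemma laplaceMeasure₂_eq_integral (hμ : ∀ᵐ v ∂μ, 0 ≤ v.1 ∧ 0 ≤ v.2) (u s : ℝ) :
    laplaceMeasure₂ μ u s = ∫ v, Real.exp (-(u * v.1) - s * v.2) ∂μ := by
  rw [laplaceMeasure₂, Measure.restrict_eq_self_of_ae_mem]
  filter_upwards [hμ] with v hv using ⟨hv.1, hv.2⟩

namespace IsShockProcess

lemma ae_increment_nonneg (hS : IsShockProcess P N V lam p μ) :
    ∀ᵐ ω ∂P, ∀ i, 0 ≤ (V i ω).1 ∧ 0 ≤ (V i ω).2 :=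
  ae_all_iff.2 fun i => ae_of_ae_map (hS.marking.measurable i).aemeasurable
    ((hS.marking.law i).map_eq.symm ▸ hS.increment_nonneg)

lemma measurable_compound_snd (hS : IsShockProcess P N V lam p μ) (t : ℝ≥0) :
    Measurable fun ω => (compound N V t ω).2 :=
  measurable_snd.comp (measurable_sum_range (hS.poisson.measurable t) hS.marking.measurable)

lemma shockWeight_nonneg (hS : IsShockProcess P N V lam p μ) (t : ℝ≥0) (ω : Ω) :
    0 ≤ shockWeight N V p t ω :=
  mul_nonneg (Real.exp_nonneg _) (Finset.prod_nonneg fun _ _ =>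
    sub_nonneg.2 (hS.fatality_mem _ (NNReal.coe_nonneg _)).2)

lemma shockWeight_ae_eq_prod (hS : IsShockProcess P N V lam p μ) (t : ℝ≥0) :
    shockWeight N V p t =ᵐ[P] fun ω => ∏ i ∈ Finset.range (N t ω),
      Real.exp (-((V i ω).1 * (t - arrival N i ω))) * (1 - p (arrival N i ω)) := by
  filter_upwards [hS.poisson.monotone, hS.poisson.rightCont] with ω hm hr
  simp only [shockWeight, compound, Prod.fst_sum]
  rw [integral_sum_range_eq hm hr (fun i => (V i ω).1), ← Finset.sum_neg_distrib, Real.exp_sum,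
    Finset.prod_mul_distrib]

lemma aemeasurable_shockWeight (hS : IsShockProcess P N V lam p μ) (t : ℝ≥0) :
    AEMeasurable (shockWeight N V p t) P := by
  have hV := hS.marking.measurable
  have hp := hS.measurable_fatality
  exact (hS.poisson.aemeasurable_prod_arrival t
    (k := fun i z => Real.exp (-((V i z.2).1 * (t - z.1))) * (1 - p z.1))
    fun i => by fun_prop).congr (hS.shockWeight_ae_eq_prod t).symm

lemma integral_shockMeasure (hS : IsShockProcess P N V lam p μ) (t : ℝ≥0) {f : ℝ → ℝ}
    (hf : Measurable f) :
    ∫ x, f x ∂(shockMeasure P N V p t)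
      = ∫ ω, f (compound N V t ω).2 * shockWeight N V p t ω ∂P := by
  rw [shockMeasure, integral_map (hS.measurable_compound_snd t).aemeasurable
    hf.aestronglyMeasurable, integral_withDensity_eq_integral_toReal_smul₀
    (hS.aemeasurable_shockWeight t).ennreal_ofReal (ae_of_all _ fun _ => ENNReal.ofReal_lt_top)]
  simp only [ENNReal.toReal_ofReal (hS.shockWeight_nonneg t _), smul_eq_mul, mul_comm]

lemma shockFactor_nonneg (hS : IsShockProcess P N V lam p μ) (t s : ℝ) {x : ℝ} (hx : 0 ≤ x)
    (v : ℝ × ℝ) : 0 ≤ shockFactor p t s x v :=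
  mul_nonneg (sub_nonneg.2 (hS.fatality_mem x hx).2) (Real.exp_nonneg _)

lemma measurable_shockFactor (hS : IsShockProcess P N V lam p μ) (t s : ℝ) :
    Measurable (Function.uncurry (shockFactor p t s)) := by
  have hp := hS.measurable_fatality
  unfold shockFactor Function.uncurry
  fun_prop

lemma integral_shockFactor (hS : IsShockProcess P N V lam p μ) (t s x : ℝ) :
    ∫ v, shockFactor p t s x v ∂μ = (1 - p x) * laplaceMeasure₂ μ (t - x) s := by
  rw [laplaceMeasure₂_eq_integral hS.increment_nonneg, ← integral_const_mul]
  rfl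

lemma ae_shockFactor_le_one (hS : IsShockProcess P N V lam p μ) {t s x : ℝ} (hs : 0 ≤ s)
    (hx : x ∈ Set.Icc 0 t) : ∀ᵐ v ∂μ, shockFactor p t s x v ≤ 1 := by
  filter_upwards [hS.increment_nonneg] with v hv
  refine mul_le_one₀ (sub_le_self _ (hS.fatality_mem x hx.1).1) (Real.exp_nonneg _) ?_
  rw [Real.exp_le_one_iff]
  linarith [mul_nonneg (sub_nonneg.2 hx.2) hv.1, mul_nonneg hs hv.2]

lemma nuTilde_eq_exp_integral [IsProbabilityMeasure P] (hS : IsShockProcess P N V lam p μ)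
    {t s : ℝ} (ht : 0 ≤ t) (hs : 0 ≤ s) :
    nuTilde lam p μ t s
      = Real.exp (∫ x in 0..t, ((∫ v, shockFactor p t s x v ∂μ) - 1) * lam x) := by
  have := (hS.marking.law 0).isProbabilityMeasure_iff.1 inferInstance
  have hlam := hS.intensity.integrable t ht
  have integrable_qlam : IntervalIntegrable
      (fun x => (∫ v, shockFactor p t s x v ∂μ) * lam x) volume 0 t := by
    refine hlam.mono_fun ((hS.measurable_shockFactor t s).stronglyMeasurable.integral_prod_right
      |>.aestronglyMeasurable.mul hlam.def'.aestronglyMeasurable) ?_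
    filter_upwards [ae_restrict_mem measurableSet_uIoc] with x hx
    rw [Set.uIoc_of_le ht] at hx
    rw [norm_mul]
    refine mul_le_of_le_one_left (norm_nonneg _) ?_
    refine (norm_integral_le_of_norm_le_const (C := 1) ?_).trans (by simp)
    filter_upwards [hS.ae_shockFactor_le_one hs (Set.Ioc_subset_Icc_self hx)] with v hv
    rwa [Real.norm_eq_abs, abs_of_nonneg (hS.shockFactor_nonneg t s hx.1.le v)]
  simp_rw [sub_mul, one_mul]
  rw [intervalIntegral.integral_sub integrable_qlam hlam, nuTilde, cumIntensity, convFun,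
    neg_add_eq_sub]
  simp_rw [hS.integral_shockFactor, qlam, mul_right_comm]

lemma ofReal_exp_mul_shockWeight_ae_eq (hS : IsShockProcess P N V lam p μ) (t : ℝ≥0) (s : ℝ) :
    (fun ω => ENNReal.ofReal (Real.exp (-(s * (compound N V t ω).2)) * shockWeight N V p t ω))
      =ᵐ[P] fun ω => ∏ i ∈ Finset.range (N t ω),
        ENNReal.ofReal (shockFactor p t s (arrival N i ω) (V i ω)) := by
  filter_upwards [hS.shockWeight_ae_eq_prod t] with ω hω
  rw [hω, ← ENNReal.ofReal_prod_of_nonneg fun i _ =>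
      hS.shockFactor_nonneg t s (NNReal.coe_nonneg _) _, compound, Prod.snd_sum, Finset.mul_sum,
    ← Finset.sum_neg_distrib, Real.exp_sum, ← Finset.prod_mul_distrib]
  refine congrArg ENNReal.ofReal (Finset.prod_congr rfl fun i _ => ?_)
  rw [shockFactor, ← mul_assoc, ← Real.exp_add, mul_comm]
  ring_nf

lemma lintegral_exp_mul_shockWeight [IsProbabilityMeasure P]
    (hS : IsShockProcess P N V lam p μ) (t : ℝ≥0) {s : ℝ} (hs : 0 ≤ s) :
    ∫⁻ ω, ENNReal.ofReal (Real.exp (-(s * (compound N V t ω).2)) * shockWeight N V p t ω) ∂P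
      = ENNReal.ofReal (nuTilde lam p μ t s) := by
  have := (hS.marking.law 0).isProbabilityMeasure_iff.1 inferInstance
  have hfactor := hS.measurable_shockFactor t s
  have lintegral_le_one (x : ℝ) (hx : x ∈ Set.Icc (0 : ℝ) t) :
      ∫⁻ v, ENNReal.ofReal (shockFactor p t s x v) ∂μ ≤ 1 := by
    calc ∫⁻ v, ENNReal.ofReal (shockFactor p t s x v) ∂μ ≤ ∫⁻ _, 1 ∂μ :=
          lintegral_mono_ae ((hS.ae_shockFactor_le_one hs hx).mono fun v hv =>
            ENNReal.ofReal_le_one.2 hv)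
      _ = 1 := by simp
  rw [lintegral_congr_ae (hS.ofReal_exp_mul_shockWeight_ae_eq t s),
    hS.poisson.lintegral_prod_marks hS.intensity hS.marking t
      (k := fun z => ENNReal.ofReal (shockFactor p t s z.1 z.2)) hfactor.ennreal_ofReal
      lintegral_le_one,
    hS.nuTilde_eq_exp_integral t.coe_nonneg hs]
  congr 2
  refine intervalIntegral.integral_congr fun x hx => ?_
  rw [Set.uIcc_of_le t.coe_nonneg] at hx
  simp only [integral_eq_lintegral_of_nonneg_ae
    (ae_of_all μ (hS.shockFactor_nonneg t s hx.1))
    (hfactor.comp measurable_prodMk_left).aestronglyMeasurable]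

lemma isFiniteMeasure_shockMeasure [IsProbabilityMeasure P]
    (hS : IsShockProcess P N V lam p μ) (t : ℝ≥0) : IsFiniteMeasure (shockMeasure P N V p t) := by
  have : IsFiniteMeasure (P.withDensity fun ω => ENNReal.ofReal (shockWeight N V p t ω)) :=
    isFiniteMeasure_withDensity <| by
      simpa using (hS.lintegral_exp_mul_shockWeight t le_rfl).trans_ne ENNReal.ofReal_ne_top
  exact Measure.isFiniteMeasure_map _ _

lemma shockMeasure_Iio (hS : IsShockProcess P N V lam p μ) (t : ℝ≥0) :
    shockMeasure P N V p t (Set.Iio 0) = 0 := by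
  rw [shockMeasure, Measure.map_apply (hS.measurable_compound_snd t) measurableSet_Iio]
  refine withDensity_absolutelyContinuous _ _ (measure_eq_zero_iff_ae_notMem.2 ?_)
  filter_upwards [hS.ae_increment_nonneg] with ω hV
  rw [Set.mem_preimage, Set.mem_Iio, not_lt, compound, Prod.snd_sum]
  exact Finset.sum_nonneg fun i _ => (hV i).2

theorem hasLaplaceTransform_shockMeasure [IsProbabilityMeasure P]
    (hS : IsShockProcess P N V lam p μ) (t : ℝ≥0) :
    HasLaplaceTransform (shockMeasure P N V p t) (nuTilde lam p μ t) where
  finite := hS.isFiniteMeasure_shockMeasure t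
  support := hS.shockMeasure_Iio t
  eq s hs := by
    have hA := hS.measurable_compound_snd t
    rw [laplaceMeasure, restrict_Ici_eq_self (hS.shockMeasure_Iio t),
      hS.integral_shockMeasure t (by fun_prop), integral_eq_lintegral_of_nonneg_ae,
      hS.lintegral_exp_mul_shockWeight t hs, ENNReal.toReal_ofReal]
    · exact Real.exp_nonneg _
    · exact ae_of_all _ fun ω => mul_nonneg (Real.exp_nonneg _) (hS.shockWeight_nonneg t ω)
    · exact ((hA.const_mul s).neg.exp.aemeasurable.mul
        (hS.aemeasurable_shockWeight t)).aestronglyMeasurable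

lemma phi_eq_integral_shockMeasure (hS : IsShockProcess P N V lam p μ) (G : ℝ≥0 → Ω → ℝ)
    (t : ℝ≥0) (L : ℝ) :
    phi P N V G p t L = ∫ x, cdf (P.map (G t)) (L - x) ∂(shockMeasure P N V p t) := by
  rw [hS.integral_shockMeasure t (f := fun x => cdf (P.map (G t)) (L - x))
    ((monotone_cdf _).measurable.comp (measurable_const_sub L))]
  simp only [phi, shockWeight, mul_assoc]

end IsShockProcess

end ShockMeasure

lemma IsShockModel.isShockProcess {Ω : Type*} [MeasurableSpace Ω] {P : Measure Ω}
    {N : ℝ≥0 → Ω → ℕ} {V : ℕ → Ω → ℝ × ℝ} {G : ℝ≥0 → Ω → ℝ} {lam p : ℝ → ℝ}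
    {μ : Measure (ℝ × ℝ)} (hM : IsShockModel P N V G lam p μ) :
    IsShockProcess P N V lam p μ where
  intensity := ⟨hM.lam_nonneg, hM.lam_integrable⟩
  poisson := hM.poisson
  marking := ⟨hM.V_measurable, hM.V_law, hM.V_indep, hM.V_indep_N⟩
  measurable_fatality := hM.p_measurable
  fatality_mem := hM.p_mem
  increment_nonneg := hM.V_nonneg

lemma cdf_eq_zero_of_neg {ρ : Measure ℝ} [IsProbabilityMeasure ρ] (hρ : ∀ᵐ x ∂ρ, 0 ≤ x) {x : ℝ}
    (hx : x < 0) : cdf ρ x = 0 := by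
  rw [cdf_eq_real, measureReal_eq_zero_iff, measure_eq_zero_iff_ae_notMem]
  filter_upwards [hρ] with y hy
  exact not_le.2 (hx.trans_le hy)

lemma integrableOn_cdf_sub (ρ : Measure ℝ) (ν : Measure ℝ) [IsFiniteMeasure ν] (L : ℝ)
    (S : Set ℝ) : IntegrableOn (fun x => cdf ρ (L - x)) S ν :=
  Integrable.of_mem_Icc 0 1
    ((monotone_cdf ρ).measurable.comp (measurable_const_sub L)).aemeasurable
    (ae_of_all _ fun _ => ⟨cdf_nonneg ρ _, cdf_le_one ρ _⟩)

lemma IsShockProcess.phi_eq_convMeasure {Ω : Type*} [MeasurableSpace Ω] {P : Measure Ω}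
    [IsProbabilityMeasure P] {N : ℝ≥0 → Ω → ℕ} {V : ℕ → Ω → ℝ × ℝ} {G : ℝ≥0 → Ω → ℝ}
    {lam p : ℝ → ℝ} {μ : Measure (ℝ × ℝ)} (hS : IsShockProcess P N V lam p μ) {t : ℝ≥0}
    (hG : AEMeasurable (G t) P) (hG0 : ∀ᵐ ω ∂P, 0 ≤ G t ω) :
    phi P N V G p t = convMeasure (cdf (P.map (G t))) (shockMeasure P N V p t) := by
  have := Measure.isProbabilityMeasure_map (μ := P) hG
  have cdf_neg (x : ℝ) (hx : x < 0) : cdf (P.map (G t)) x = 0 :=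
    cdf_eq_zero_of_neg ((ae_map_iff hG measurableSet_Ici).2 hG0) hx
  funext L
  rw [hS.phi_eq_integral_shockMeasure, convMeasure_eq_integral cdf_neg (hS.shockMeasure_Iio t)]

end ShockModel

theorem mainTheorem5_general {Ω : Type*} [MeasurableSpace Ω] (P : Measure Ω)
    [IsProbabilityMeasure P] (N : ℝ≥0 → Ω → ℕ) (V : ℕ → Ω → ℝ × ℝ) (G : ℝ≥0 → Ω → ℝ)
    (lam p : ℝ → ℝ) (μ : Measure (ℝ × ℝ)) (hS : ShockModel.IsShockProcess P N V lam p μ) (t : ℝ≥0)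
    (hG : AEMeasurable (G t) P) (hG0 : ∀ᵐ ω ∂P, 0 ≤ G t ω) :
    (∀ s : ℝ, 0 ≤ s →
      ShockModel.laplaceFun (ShockModel.phi P N V G p t) s =
        ShockModel.laplaceFun (fun x => cdf (P.map (G t)) x) s
          * ENNReal.ofReal (ShockModel.nuTilde lam p μ t s)) ∧
    (∃! ν : Measure ℝ, ShockModel.HasLaplaceTransform ν (ShockModel.nuTilde lam p μ t)) ∧
    (∀ ν : Measure ℝ, ShockModel.HasLaplaceTransform ν (ShockModel.nuTilde lam p μ t) →
      ∀ L : ℝ, 0 ≤ L →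
        ShockModel.phi P N V G p t L =
          ShockModel.convMeasure (fun x => cdf (P.map (G t)) x) ν L) ∧
    (IndepFun (Prod.fst : ℝ × ℝ → ℝ) Prod.snd μ →
      ∀ s : ℝ, 0 ≤ s →
        ShockModel.nuTilde lam p μ t s =
          Real.exp (-ShockModel.cumIntensity lam t
            + ShockModel.aFun lam p μ t * ShockModel.laplaceMeasure (μ.map Prod.snd) s)) := by
  have hν := hS.hasLaplaceTransform_shockMeasure t
  have := hν.finite
  have hφ := hS.phi_eq_convMeasure hG hG0
  refine ⟨fun s hs => ?_, ⟨_, hν, fun ν h => h.unique hν⟩, fun ν h L _ => ?_,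
    fun h s _ => ShockModel.nuTilde_eq_of_indepFun h lam p t s⟩
  · rw [hφ, ← hν.eq s hs]
    exact ShockModel.laplaceFun_convMeasure (monotone_cdf _).measurable
      (fun x _ => cdf_nonneg _ x) (fun L => ShockModel.integrableOn_cdf_sub _ _ L _) hs
  · rw [hφ, h.unique hν]

theorem mainTheorem5 {Ω : Type*} [MeasurableSpace Ω] (P : Measure Ω) [IsProbabilityMeasure P]
    (N : ℝ≥0 → Ω → ℕ) (V : ℕ → Ω → ℝ × ℝ) (G : ℝ≥0 → Ω → ℝ) (lam p : ℝ → ℝ)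
    (μ : Measure (ℝ × ℝ)) (hM : ShockModel.IsShockModel P N V G lam p μ) (t : ℝ≥0) :
    -- the Laplace transform in `L` factorizes
    (∀ s : ℝ, 0 ≤ s →
      ShockModel.laplaceFun (ShockModel.phi P N V G p t) s =
        ShockModel.laplaceFun (fun x => cdf (P.map (G t)) x) s
          * ENNReal.ofReal (ShockModel.nuTilde lam p μ t s)) ∧
    -- there is exactly one measure `ν_t` with the given Laplace transform
    (∃! ν : Measure ℝ, ShockModel.HasLaplaceTransform ν (ShockModel.nuTilde lam p μ t)) ∧
    -- and `φ_t = F_{G_t} * ν_t`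
    (∀ ν : Measure ℝ, ShockModel.HasLaplaceTransform ν (ShockModel.nuTilde lam p μ t) →
      ∀ L : ℝ, 0 ≤ L →
        ShockModel.phi P N V G p t L =
          ShockModel.convMeasure (fun x => cdf (P.map (G t)) x) ν L) ∧
    -- the case of independent `V⁽¹⁾`, `V⁽²⁾`
    (IndepFun (Prod.fst : ℝ × ℝ → ℝ) Prod.snd μ →
      ∀ s : ℝ, 0 ≤ s →
        ShockModel.nuTilde lam p μ t s =
          Real.exp (-ShockModel.cumIntensity lam t
            + ShockModel.aFun lam p μ t * ShockModel.laplaceMeasure (μ.map Prod.snd) s)) :=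
  mainTheorem5_general P N V G lam p μ hM.isShockProcess t (hM.G_measurable t).aemeasurable
    (hM.G_nonneg.mono fun _ h => h t)
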